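/- Let $A$ be a finite set of agents, $P'$ a countable set, and $P\subseteq P'\times A$ a set of propositional variables; write $p_a$ for $(p,a)\in P$, and for $Q\subseteq P$ let $Q_a=\{(p,b)\in Q : b=a\}$ (the local variables of $a$ in $Q$). A *communication graph* is a reflexive relation $R\subseteq A\times A$, with $Rb=\{a : (a,b)\in R\}$ and $RB=\bigcup_{b\in B}Rb$; for $B\subseteq A$, $R'B\equiv RB$ means that $R'a=Ra$ for all $a\in B$. A *communication pattern* $\mathbf R$ is a set of communication graphs. The language of *communication pattern logic* is $$\varphi ::= p_a \mid \neg\varphi\mid \varphi\wedge\varphi\mid D_B\varphi\mid [\mathbf R,R]\varphi,$$ with $p_a\in P$, $B\subseteq A$, $\mathbf R$ a communication pattern and $R\in\mathbf R$; $\vee,\to,\leftrightarrow$ are the usual abbreviations and $K_a=D_{\{a\}}$. A *local epistemic model* $M=(W,\sim,L)$ consists of a set $W$ of worlds, an equivalence relation $\sim_a$ on $W$ for each $a\in A$, and a valuation $L:W\to\mathcal P(P)$ such that $v\sim_a w$ implies $L(v)_a=L(w)_a$. Put $\sim_B=\bigcap_{a\in B}\sim_a$ (so $\sim_\emptyset=W\times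 W$). The update $M\odot\mathbf R$ has worlds $W\times\mathbf R$, relations $(w,R)\mathrel{\dot\sim_a}(w',R')$ iff $w\sim_{Ra}w'$ and $Ra=R'a$, and valuation $\dot L(w,R)=L(w)$. Satisfaction: $M,w\models p_a$ iff $p_a\in L(w)$; Boolean clauses as usual; $M,w\models D_B\varphi$ iff $M,v\models\varphi$ for all $v\sim_B w$; $M,w\models[\mathbf R,R]\varphi$ iff $M\odot\mathbf R,(w,R)\models\varphi$. A formula is *valid* if it is true at every world of every local epistemic model. The Hilbert system has the following axioms and rules, for all formulas $\varphi,\psi,\chi$, all $p_a\in P$, all $B\subseteq C\subseteq A$, and all communication patterns $\mathbf R$ and $R\in\mathbf R$: - (P) all instances of propositional tautologies; - (L) $K_ap_a\vee K_a\neg p_a$; - (K$^D$) $D_B(\varphi\to\psi)\to D_B\varphi\to D_B\psi$; - (T$^D$) $D_B\varphi\to\varphi$; - (4$^D$) $D_B\varphi\to D_BD_B\varphi$; - (5$^D$) $\neg D_B\varphi\to D_B\neg D_B\varphi$; - (W) $D_B\varphi\to D_C\varphi$; - (C$^1$) $[\mathbf R,R]p_a\leftrightarrow p_a$; - (C$^2$)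 $[\mathbf R,R]\neg\varphi\leftrightarrow\neg[\mathbf R,R]\varphi$; - (C$^3$) $[\mathbf R,R](\varphi\wedge\psi)\leftrightarrow([\mathbf R,R]\varphi\wedge[\mathbf R,R]\psi)$; - (C$^4$) $[\mathbf R,R]D_B\varphi\leftrightarrow\bigwedge_{R'\in\mathbf R,\ R'B\equiv RB}D_{RB}[\mathbf R,R']\varphi$; - (MP) from $\varphi\to\psi$ and $\varphi$ infer $\psi$; - (N$^D$) from $\varphi$ infer $D_B\varphi$; - (N$^\odot$) from $\varphi$ infer $[\mathbf R,R]\varphi$; - (RE) from $\varphi\leftrightarrow\psi$ infer $\chi[p_a/\varphi]\leftrightarrow\chi[p_a/\psi]$, where $\chi[p_a/\varphi]$ is the result of replacing every occurrence of the atom $p_a$ in $\chi$ by $\varphi$. **Theorem.** This system is sound and complete for communication pattern logic on local epistemic models: a formula is derivable in it if and only if it is valid. -/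

import Mathlib

universe w

namespace CommunicationPatternLogic

/-- A communication graph on `A`: a reflexive binary relation. `(a, b) ∈ R.edges` means that the
message sent by `a` is received by `b`. -/
structure CommGraph (A : Type) where
  edges : Set (A × A)
  refl : ∀ a, (a, a) ∈ edges

/-- A communication pattern: a set of communication graphs. -/
abbrev CommPattern (A : Type) := Set (CommGraph A)

namespace CommGraph

variable {A : Type}

/-- The in-neighbourhood `R b = {a | (a, b) ∈ R}`. -/
def inNbhd (R : CommGraph A) (b : A) : Set A := {a | (a, b) ∈ R.edges}

/-- `R B`, the union of the in-neighbourhoods `R b` for `b ∈ B`. -/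
def inNbhdSet (R : CommGraph A) (B : Set A) : Set A := ⋃ b ∈ B, R.inNbhd b

/-- `R B ≡ R' B`: for all `a ∈ B`, `R a = R' a`. -/
def EquivOn (B : Set A) (R R' : CommGraph A) : Prop := ∀ a ∈ B, R.inNbhd a = R'.inNbhd a

end CommGraph

/-- The agent `a` to whom the propositional variable `p_a = (p, a) ∈ P` belongs. -/
def owner {A P' : Type} {P : Set (P' × A)} (p : P) : A := p.1.2

/-- A (local) epistemic model with domain `W`, for agents `A` and variables `P ⊆ P' × A`. -/
structure EpistemicModel {A P' : Type} (P : Set (P' × A)) (W : Type w) where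
  rel : A → W → W → Prop
  equivalence : ∀ a, Equivalence (rel a)
  val : W → Set P
  locality : ∀ a v w, rel a v w → {p ∈ val v | owner p = a} = {p ∈ val w | owner p = a}

namespace EpistemicModel

variable {A P' : Type} {P : Set (P' × A)} {W : Type w}

/-- `∼_B`, the intersection of the relations `∼_a` for `a ∈ B` (the universal relation on the
domain if `B` is empty). -/
def groupRel (M : EpistemicModel P W) (B : Set A) (v w : W) : Prop := ∀ a ∈ B, M.rel a v w

/-- The updated epistemic model `M ⊙ 𝓡`. -/
def update (M : EpistemicModel P W) (𝓡 : CommPattern A) : EpistemicModel P (W × 𝓡) where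
  rel a x y := M.groupRel (x.2.1.inNbhd a) x.1 y.1 ∧ x.2.1.inNbhd a = y.2.1.inNbhd a
  equivalence _ :=
    { refl := fun x => ⟨fun b _ => (M.equivalence b).refl x.1, rfl⟩
      symm := fun {_ _} h =>
        ⟨fun b hb => (M.equivalence b).symm (h.1 b (h.2 ▸ hb)), h.2.symm⟩
      trans := fun {_ _ _} h h' =>
        ⟨fun b hb => (M.equivalence b).trans (h.1 b hb) (h'.1 b (h.2 ▸ hb)), h.2.trans h'.2⟩ }
  val x := M.val x.1
  locality a x y h := M.locality a x.1 y.1 (h.1 a (x.2.1.refl a))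

end EpistemicModel

/-- The language: `p_a`, `¬φ`, `φ ∧ ψ`, `D_B φ`, and `[𝓡, R]φ` where `R ∈ 𝓡`. -/
inductive Form {A P' : Type} (P : Set (P' × A)) : Type
  | atom (p : P) : Form P
  | neg (φ : Form P) : Form P
  | and (φ ψ : Form P) : Form P
  | dist (B : Set A) (φ : Form P) : Form P
  | upd (𝓡 : CommPattern A) (R : 𝓡) (φ : Form P) : Form P

namespace Form

variable {A P' : Type} {P : Set (P' × A)}

/-- Disjunction, as an abbreviation. -/
def or (φ ψ : Form P) : Form P := neg (and (neg φ) (neg ψ))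

/-- Implication, as an abbreviation. -/
def imp (φ ψ : Form P) : Form P := neg (and φ (neg ψ))

/-- Bi-implication, as an abbreviation. -/
def iff (φ ψ : Form P) : Form P := and (imp φ ψ) (imp ψ φ)

/-- `K_a φ`, the abbreviation of `D_{a} φ`. -/
def know (a : A) (φ : Form P) : Form P := dist {a} φ

/-- The conjunction of the nonempty list `φ :: l`. -/
def conj : Form P → List (Form P) → Form P
  | φ, [] => φ
  | φ, ψ :: l => and φ (conj ψ l)

open Classical in
/-- `χ.subst p φ` is `χ[p/φ]`, the replacement of every occurrence of the atom `p` in `χ`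
by `φ`. -/
noncomputable def subst (p : P) (φ : Form P) : Form P → Form P
  | atom q => if q = p then φ else atom q
  | neg χ => neg (subst p φ χ)
  | and χ₁ χ₂ => and (subst p φ χ₁) (subst p φ χ₂)
  | dist B χ => dist B (subst p φ χ)
  | upd 𝓡 R χ => upd 𝓡 R (subst p φ χ)

/-- Satisfaction `M, w ⊨ φ`. -/
def Sat : Form P → {W : Type w} → EpistemicModel P W → W → Prop
  | atom p, _, M, w => p ∈ M.val w
  | neg φ, _, M, w => ¬ Sat φ M w
  | and φ ψ, _, M, w => Sat φ M w ∧ Sat ψ M w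
  | dist B φ, _, M, w => ∀ v, M.groupRel B v w → Sat φ M v
  | upd 𝓡 R φ, _, M, w => Sat φ (M.update 𝓡) (w, R)

/-- Validity: truth in all pointed (local) epistemic models. -/
def Valid (φ : Form P) : Prop :=
  ∀ (W : Type w) (M : EpistemicModel P W) (x : W), Sat φ M x

/-- Instances of propositional tautologies: the formulas that come out true under every truth
assignment to formulas that respects negation and conjunction (formulas of any other shape being
treated as propositional letters). -/
def TautologyInstance (φ : Form P) : Prop :=
  ∀ t : Form P → Prop, (∀ α, t (neg α) ↔ ¬ t α) → (∀ α β, t (and α β) ↔ t α ∧ t β) → t φ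

/-- The theorems of the axiomatization of communication pattern logic. In `C4` the conjunction runs
over all `R' ∈ 𝓡` with `R' B ≡ R B`, listed without repetition, in any order, as `R₀ :: l`. -/
inductive Theorem : Form P → Prop
  | P (φ : Form P) : TautologyInstance φ → Theorem φ
  | L (p : P) : Theorem (or (know (owner p) (atom p)) (know (owner p) (neg (atom p))))
  | KD (B : Set A) (φ ψ : Form P) :
      Theorem (imp (dist B (imp φ ψ)) (imp (dist B φ) (dist B ψ)))
  | TD (B : Set A) (φ : Form P) : Theorem (imp (dist B φ) φ)
  | D4 (B : Set A) (φ : Form P) : Theorem (imp (dist B φ) (dist B (dist B φ)))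
  | D5 (B : Set A) (φ : Form P) : Theorem (imp (neg (dist B φ)) (dist B (neg (dist B φ))))
  | W (B C : Set A) (φ : Form P) : B ⊆ C → Theorem (imp (dist B φ) (dist C φ))
  | C1 (𝓡 : CommPattern A) (R : 𝓡) (p : P) : Theorem (iff (upd 𝓡 R (atom p)) (atom p))
  | C2 (𝓡 : CommPattern A) (R : 𝓡) (φ : Form P) :
      Theorem (iff (upd 𝓡 R (neg φ)) (neg (upd 𝓡 R φ)))
  | C3 (𝓡 : CommPattern A) (R : 𝓡) (φ ψ : Form P) :
      Theorem (iff (upd 𝓡 R (and φ ψ)) (and (upd 𝓡 R φ) (upd 𝓡 R ψ)))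
  | C4 (𝓡 : CommPattern A) (R : 𝓡) (B : Set A) (φ : Form P) (R₀ : 𝓡) (l : List 𝓡) :
      (R₀ :: l).Nodup →
      (∀ R' : 𝓡, R' ∈ R₀ :: l ↔ CommGraph.EquivOn B R'.1 R.1) →
      Theorem (iff (upd 𝓡 R (dist B φ))
        (conj (dist (R.1.inNbhdSet B) (upd 𝓡 R₀ φ))
          (l.map fun R' => dist (R.1.inNbhdSet B) (upd 𝓡 R' φ))))
  | MP (φ ψ : Form P) : Theorem (imp φ ψ) → Theorem φ → Theorem ψ
  | ND (B : Set A) (φ : Form P) : Theorem φ → Theorem (dist B φ)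
  | NU (𝓡 : CommPattern A) (R : 𝓡) (φ : Form P) : Theorem φ → Theorem (upd 𝓡 R φ)
  | RE (χ : Form P) (p : P) (φ ψ : Form P) :
      Theorem (iff φ ψ) → Theorem (iff (subst p φ χ) (subst p ψ χ))

end Form

end CommunicationPatternLogic

/-!
Soundness is an induction on derivations. For completeness, the axioms `C1`–`C4` push an update
modality through a formula without updates until it meets an atom and disappears; working from the
innermost update outwards, every formula is provably equivalent to one without updates
(`exists_updFree_iff`). By soundness it then suffices to treat formulas without updates, where the
logic is `S5` with distributed knowledge and local atoms.

There, maximal consistent sets carry one equivalence relation `∼_B` for each group `B`, namely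
agreement on all formulas `D_B ψ`, and `∼_C ⊆ ∼_B` when `B ⊆ C`. The usual truth lemma would hold,
except that `∼_B` may be strictly smaller than the intersection of the `∼_a` with `a ∈ B`.
`exists_realisation` repairs this without unravelling. Worlds are equipped with an additional
ledger `g : Set A → (X →₀ ℤ)`, and a step along `∼_B` from `x` to `y` adds `y - x` to the entry
`g B`. The relation of the agent `a` is: only entries of groups containing `a` change, each entry
`g C` is preserved modulo `∼_C`, and the total change of the ledger equals the change of world.
These relations are equivalence relations by their form. If `(x, g)` and `(y, h)` are related for
every `a ∈ B`, where `B` is nonempty, then only entries of groups `C ⊇ B` differ, so `y - x` is a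
sum of chains which vanish modulo `∼_B`, and hence `x ∼_B y`. For empty `B` the relation `∼_B` must
be universal, which is achieved by restricting to one class of `∼_∅`.
-/

namespace CommunicationPatternLogic

namespace Form

variable {A P' : Type} {P : Set (P' × A)}

/-! ### Soundness -/

theorem sat_imp {W : Type w} (M : EpistemicModel P W) (x : W) (φ ψ : Form P) :
    Sat (imp φ ψ) M x ↔ (Sat φ M x → Sat ψ M x) := by
  simp only [imp, Sat]; tauto

theorem sat_iff {W : Type w} (M : EpistemicModel P W) (x : W) (φ ψ : Form P) :
    Sat (iff φ ψ) M x ↔ (Sat φ M x ↔ Sat ψ M x) := by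
  simp only [iff, Sat, sat_imp]; tauto

theorem sat_or {W : Type w} (M : EpistemicModel P W) (x : W) (φ ψ : Form P) :
    Sat (or φ ψ) M x ↔ (Sat φ M x ∨ Sat ψ M x) := by
  simp only [or, Sat]; tauto

theorem sat_conj {W : Type w} (M : EpistemicModel P W) (x : W) (φ : Form P)
    (l : List (Form P)) : Sat (conj φ l) M x ↔ ∀ ψ ∈ φ :: l, Sat ψ M x := by
  induction l generalizing φ with
  | nil => simp [conj]
  | cons ψ l ih => simp only [conj, Sat, ih]; simp

theorem _root_.CommunicationPatternLogic.EpistemicModel.groupRel_refl {W : Type w}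
    (M : EpistemicModel P W) (B : Set A) (x : W) : M.groupRel B x x :=
  fun a _ => (M.equivalence a).refl x

theorem _root_.CommunicationPatternLogic.EpistemicModel.groupRel_symm {W : Type w}
    {M : EpistemicModel P W} {B : Set A} {x y : W} (h : M.groupRel B x y) : M.groupRel B y x :=
  fun a ha => (M.equivalence a).symm (h a ha)

theorem _root_.CommunicationPatternLogic.EpistemicModel.groupRel_trans {W : Type w}
    {M : EpistemicModel P W} {B : Set A} {x y z : W} (h : M.groupRel B x y)
    (h' : M.groupRel B y z) : M.groupRel B x z :=
  fun a ha => (M.equivalence a).trans (h a ha) (h' a ha)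

theorem _root_.CommunicationPatternLogic.EpistemicModel.groupRel_update {W : Type w}
    (M : EpistemicModel P W) (𝓡 : CommPattern A) (B : Set A) (v w : W) (R' R : 𝓡) :
    (M.update 𝓡).groupRel B (v, R') (w, R) ↔
      M.groupRel (R.1.inNbhdSet B) v w ∧ CommGraph.EquivOn B R'.1 R.1 := by
  simp only [EpistemicModel.groupRel, EpistemicModel.update, CommGraph.inNbhdSet,
    CommGraph.EquivOn, Set.mem_iUnion]
  constructor
  · intro h
    refine ⟨?_, fun a ha => (h a ha).2⟩
    rintro b ⟨a, ha, hb⟩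
    exact (h a ha).1 b ((h a ha).2 ▸ hb)
  · rintro ⟨h₁, h₂⟩ a ha
    exact ⟨fun b hb => h₁ b ⟨a, ha, h₂ a ha ▸ hb⟩, h₂ a ha⟩

/-- The two formulas have to be equivalent in all models, not only in `M`, since an occurrence of
the atom in the scope of an update is evaluated in an updated model. -/
theorem sat_subst_congr {p : P} {φ ψ : Form P}
    (h : ∀ (W : Type w) (M : EpistemicModel P W) (x : W), Sat φ M x ↔ Sat ψ M x) (χ : Form P) :
    ∀ (W : Type w) (M : EpistemicModel P W) (x : W),
      Sat (subst p φ χ) M x ↔ Sat (subst p ψ χ) M x := by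
  induction χ with
  | atom q =>
    intro W M x
    by_cases hq : q = p
    · simpa [subst, hq] using h W M x
    · simp [subst, hq]
  | neg χ ih => intro W M x; simp only [subst, Sat, ih]
  | and χ₁ χ₂ ih₁ ih₂ => intro W M x; simp only [subst, Sat, ih₁, ih₂]
  | dist B χ ih => intro W M x; simp only [subst, Sat, ih]
  | upd 𝓡 R χ ih => intro W M x; simp only [subst, Sat, ih]

theorem Theorem.sound {φ : Form P} (h : Theorem φ) : Valid.{w} φ := by
  induction h with
  | P φ h =>
    intro W M x
    exact h (fun ψ => Sat ψ M x) (fun _ => Iff.rfl) (fun _ _ => Iff.rfl)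
  | L p =>
    intro W M x
    have key : ∀ v, M.groupRel {owner p} v x → (p ∈ M.val v ↔ p ∈ M.val x) := by
      intro v hv
      have := congrArg (p ∈ ·) (M.locality (owner p) v x (hv _ rfl))
      simpa using this
    simp only [sat_or, know, Sat]
    by_cases hp : p ∈ M.val x
    · exact Or.inl fun v hv => (key v hv).2 hp
    · exact Or.inr fun v hv hv' => hp ((key v hv).1 hv')
  | KD B φ ψ =>
    intro W M x
    simp only [sat_imp, Sat]
    exact fun h₁ h₂ v hv => h₁ v hv (h₂ v hv)
  | TD B φ =>
    intro W M x
    simp only [sat_imp, Sat]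
    exact fun h => h x (M.groupRel_refl B x)
  | D4 B φ =>
    intro W M x
    simp only [sat_imp, Sat]
    exact fun h v hv u hu => h u (EpistemicModel.groupRel_trans hu hv)
  | D5 B φ =>
    intro W M x
    simp only [sat_imp, Sat]
    exact fun h v hv h' => h fun u hu =>
      h' u (EpistemicModel.groupRel_trans hu (EpistemicModel.groupRel_symm hv))
  | W B C φ hBC =>
    intro W M x
    simp only [sat_imp, Sat]
    exact fun h v hv => h v fun a ha => hv a (hBC ha)
  | C1 𝓡 R p => intro W M x; simp only [sat_iff, Sat]; exact Iff.rfl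
  | C2 𝓡 R φ => intro W M x; simp only [sat_iff, Sat]
  | C3 𝓡 R φ ψ => intro W M x; simp only [sat_iff, Sat]
  | C4 𝓡 R B φ R₀ l _ hl =>
    intro W M x
    have hmap : dist (R.1.inNbhdSet B) (upd 𝓡 R₀ φ) ::
        l.map (fun R' => dist (R.1.inNbhdSet B) (upd 𝓡 R' φ)) =
        (R₀ :: l).map fun R' => dist (R.1.inNbhdSet B) (upd 𝓡 R' φ) := rfl
    rw [sat_iff, sat_conj, hmap, List.forall_mem_map]
    simp only [Sat, Prod.forall, EpistemicModel.groupRel_update, hl]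
    exact ⟨fun h R' hR' v hv => h v R' ⟨hv, hR'⟩, fun h v R' hv => h R' hv.2 v hv.1⟩
  | MP φ ψ _ _ ih₁ ih₂ =>
    intro W M x
    exact (sat_imp M x φ ψ).1 (ih₁ W M x) (ih₂ W M x)
  | ND B φ _ ih => intro W M x v _; exact ih W M v
  | NU 𝓡 R φ _ ih => intro W M x; exact ih _ (M.update 𝓡) (x, R)
  | RE χ p φ ψ _ ih =>
    intro W M x
    rw [sat_iff]
    exact sat_subst_congr (fun W M x => (sat_iff M x φ ψ).1 (ih W M x)) χ W M x

/-! ### Elimination of updates -/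

theorem Theorem.of_taut {α β : Form P} (h : Theorem α) (ht : TautologyInstance (imp α β)) :
    Theorem β :=
  .MP _ _ (.P _ ht) h

theorem Theorem.of_taut₂ {α β γ : Form P} (h₁ : Theorem α) (h₂ : Theorem β)
    (ht : TautologyInstance (imp α (imp β γ))) : Theorem γ :=
  .MP _ _ (h₁.of_taut ht) h₂

theorem Theorem.iff_refl (φ : Form P) : Theorem (iff φ φ) :=
  .P _ fun t hn ha => by simp only [iff, imp, hn, ha]; tauto

theorem Theorem.iff_trans {φ ψ χ : Form P} (h₁ : Theorem (iff φ ψ)) (h₂ : Theorem (iff ψ χ)) :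
    Theorem (iff φ χ) :=
  h₁.of_taut₂ h₂ fun t hn ha => by simp only [iff, imp, hn, ha]; tauto

theorem Theorem.iff_mp {φ ψ : Form P} (h : Theorem (iff φ ψ)) : Theorem (imp φ ψ) :=
  h.of_taut fun t hn ha => by simp only [iff, imp, hn, ha]; tauto

theorem Theorem.iff_mpr {φ ψ : Form P} (h : Theorem (iff φ ψ)) : Theorem (imp ψ φ) :=
  h.of_taut fun t hn ha => by simp only [iff, imp, hn, ha]; tauto

theorem Theorem.iff_intro {φ ψ : Form P} (h₁ : Theorem (imp φ ψ)) (h₂ : Theorem (imp ψ φ)) :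
    Theorem (iff φ ψ) :=
  h₁.of_taut₂ h₂ fun t hn ha => by simp only [iff, imp, hn, ha]; tauto

theorem Theorem.neg_congr {φ ψ : Form P} (h : Theorem (iff φ ψ)) :
    Theorem (iff (neg φ) (neg ψ)) :=
  h.of_taut fun t hn ha => by simp only [iff, imp, hn, ha]; tauto

theorem Theorem.and_congr {φ φ' ψ ψ' : Form P} (h₁ : Theorem (iff φ φ'))
    (h₂ : Theorem (iff ψ ψ')) : Theorem (iff (and φ ψ) (and φ' ψ')) :=
  h₁.of_taut₂ h₂ fun t hn ha => by simp only [iff, imp, hn, ha]; tauto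

theorem Theorem.dist_congr (B : Set A) {φ ψ : Form P} (h : Theorem (iff φ ψ)) :
    Theorem (iff (dist B φ) (dist B ψ)) :=
  .iff_intro (.MP _ _ (.KD B φ ψ) (.ND B _ h.iff_mp)) (.MP _ _ (.KD B ψ φ) (.ND B _ h.iff_mpr))

theorem Theorem.upd_mono (𝓡 : CommPattern A) (R : 𝓡) {φ ψ : Form P} (h : Theorem (imp φ ψ)) :
    Theorem (imp (upd 𝓡 R φ) (upd 𝓡 R ψ)) := by
  have h₁ : Theorem (iff (upd 𝓡 R (imp φ ψ)) (neg (and (upd 𝓡 R φ) (neg (upd 𝓡 R ψ))))) :=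
    (Theorem.C2 𝓡 R _).iff_trans
      (((Theorem.C3 𝓡 R φ (neg ψ)).iff_trans ((iff_refl _).and_congr (.C2 𝓡 R ψ))).neg_congr)
  exact .MP _ _ h₁.iff_mp (.NU 𝓡 R _ h)

theorem Theorem.upd_congr (𝓡 : CommPattern A) (R : 𝓡) {φ ψ : Form P} (h : Theorem (iff φ ψ)) :
    Theorem (iff (upd 𝓡 R φ) (upd 𝓡 R ψ)) :=
  .iff_intro (.upd_mono 𝓡 R h.iff_mp) (.upd_mono 𝓡 R h.iff_mpr)

theorem Theorem.conj_map_congr {ι : Type} {f g : ι → Form P} (h : ∀ i, Theorem (iff (f i) (g i)))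
    (i : ι) (l : List ι) : Theorem (iff (conj (f i) (l.map f)) (conj (g i) (l.map g))) := by
  induction l generalizing i with
  | nil => exact h i
  | cons j l ih => exact (h i).and_congr (ih j)

/-- No update modality occurs in the formula. -/
def UpdFree : Form P → Prop
  | atom _ => True
  | neg φ => UpdFree φ
  | and φ ψ => UpdFree φ ∧ UpdFree ψ
  | dist _ φ => UpdFree φ
  | upd _ _ _ => False

theorem updFree_conj {φ : Form P} {l : List (Form P)} (h : ∀ ψ ∈ φ :: l, UpdFree ψ) :
    UpdFree (conj φ l) := by
  induction l generalizing φ with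
  | nil => exact h φ (by simp)
  | cons ψ l ih =>
    exact ⟨h φ (by simp), ih fun χ hχ => h χ (List.mem_cons_of_mem _ hχ)⟩

theorem _root_.CommunicationPatternLogic.CommGraph.finite [Finite A] : Finite (CommGraph A) :=
  Finite.of_injective CommGraph.edges fun R R' h => by cases R; cases R'; simpa using h

/-- The list of graphs required by the axiom `C4` exists; it is nonempty because it contains `R`. -/
theorem exists_list_equivOn [Finite A] (𝓡 : CommPattern A) (R : 𝓡) (B : Set A) :
    ∃ (R₀ : 𝓡) (l : List 𝓡), (R₀ :: l).Nodup ∧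
      ∀ R' : 𝓡, R' ∈ R₀ :: l ↔ CommGraph.EquivOn B R'.1 R.1 := by
  classical
  have := CommGraph.finite (A := A)
  have hfin : {R' : 𝓡 | CommGraph.EquivOn B R'.1 R.1}.Finite := Set.toFinite _
  have hmem : ∀ R' : 𝓡, R' ∈ hfin.toFinset.toList ↔ CommGraph.EquivOn B R'.1 R.1 := by simp
  have hnd := hfin.toFinset.nodup_toList
  generalize hfin.toFinset.toList = l at hmem hnd
  cases l with
  | nil => exact absurd ((hmem R).2 fun _ _ => rfl) (by simp)
  | cons R₀ l => exact ⟨R₀, l, hnd, hmem⟩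

theorem UpdFree.exists_upd_iff [Finite A] (𝓡 : CommPattern A) {φ : Form P} (hφ : UpdFree φ)
    (R : 𝓡) : ∃ ψ, UpdFree ψ ∧ Theorem (iff (upd 𝓡 R φ) ψ) := by
  induction φ generalizing R with
  | atom p => exact ⟨atom p, trivial, .C1 𝓡 R p⟩
  | neg φ ih =>
    obtain ⟨ψ, hψ, h⟩ := ih hφ R
    exact ⟨neg ψ, hψ, (Theorem.C2 𝓡 R φ).iff_trans h.neg_congr⟩
  | and φ₁ φ₂ ih₁ ih₂ =>
    obtain ⟨ψ₁, hψ₁, h₁⟩ := ih₁ hφ.1 R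
    obtain ⟨ψ₂, hψ₂, h₂⟩ := ih₂ hφ.2 R
    exact ⟨and ψ₁ ψ₂, ⟨hψ₁, hψ₂⟩, (Theorem.C3 𝓡 R φ₁ φ₂).iff_trans (h₁.and_congr h₂)⟩
  | dist B φ ih =>
    choose f hf h using ih hφ
    obtain ⟨R₀, l, hnd, hl⟩ := exists_list_equivOn 𝓡 R B
    refine ⟨conj (dist (R.1.inNbhdSet B) (f R₀))
        (l.map fun R' => dist (R.1.inNbhdSet B) (f R')), updFree_conj fun ψ hψ => ?_,
      (Theorem.C4 𝓡 R B φ R₀ l hnd hl).iff_trans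
        (Theorem.conj_map_congr (fun R' => (h R').dist_congr _) R₀ l)⟩
    have hψ' : ψ ∈ (R₀ :: l).map fun R' => dist (R.1.inNbhdSet B) (f R') := hψ
    obtain ⟨R', -, rfl⟩ := List.mem_map.1 hψ'
    exact hf R'
  | upd => exact hφ.elim

theorem exists_updFree_iff [Finite A] (φ : Form P) :
    ∃ ψ, UpdFree ψ ∧ Theorem (iff φ ψ) := by
  induction φ with
  | atom p => exact ⟨atom p, trivial, .iff_refl _⟩
  | neg φ ih =>
    obtain ⟨ψ, hψ, h⟩ := ih
    exact ⟨neg ψ, hψ, h.neg_congr⟩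
  | and φ₁ φ₂ ih₁ ih₂ =>
    obtain ⟨ψ₁, hψ₁, h₁⟩ := ih₁
    obtain ⟨ψ₂, hψ₂, h₂⟩ := ih₂
    exact ⟨and ψ₁ ψ₂, ⟨hψ₁, hψ₂⟩, h₁.and_congr h₂⟩
  | dist B φ ih =>
    obtain ⟨ψ, hψ, h⟩ := ih
    exact ⟨dist B ψ, hψ, h.dist_congr B⟩
  | upd 𝓡 R φ ih =>
    obtain ⟨ψ, hψ, h⟩ := ih
    obtain ⟨χ, hχ, h'⟩ := hψ.exists_upd_iff 𝓡 R
    exact ⟨χ, hχ, (h.upd_congr 𝓡 R).iff_trans h'⟩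

/-! ### Maximal consistent sets -/

/-- Derivability from a set of hypotheses. The necessitation rules apply to theorems only, so that
the deduction theorem holds. -/
inductive Derives (Γ : Set (Form P)) : Form P → Prop
  | thm {φ : Form P} : Theorem φ → Derives Γ φ
  | hyp {φ : Form P} : φ ∈ Γ → Derives Γ φ
  | mp {φ ψ : Form P} : Derives Γ (imp φ ψ) → Derives Γ φ → Derives Γ ψ

theorem Derives.taut {Γ : Set (Form P)} {φ : Form P} (h : TautologyInstance φ) : Derives Γ φ :=
  .thm (.P _ h)

theorem Derives.deduction {Γ : Set (Form P)} {α φ : Form P} (h : Derives (insert α Γ) φ) :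
    Derives Γ (imp α φ) := by
  induction h with
  | thm h => exact .thm (h.of_taut fun t hn ha => by simp only [imp, hn, ha]; tauto)
  | @hyp φ h =>
    rcases h with rfl | h
    · exact .taut fun t hn ha => by simp only [imp, hn, ha]; tauto
    · exact .mp (.taut fun t hn ha => by simp only [imp, hn, ha]; tauto) (.hyp h)
  | @mp φ ψ _ _ ih₁ ih₂ =>
    refine .mp (.mp (.taut ?_) ih₁) ih₂
    intro t hn ha; simp only [imp, hn, ha]; tauto

theorem Derives.mono {Γ Δ : Set (Form P)} (hΓ : Γ ⊆ Δ) {φ : Form P} (h : Derives Γ φ) :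
    Derives Δ φ := by
  induction h with
  | thm h => exact .thm h
  | hyp h => exact .hyp (hΓ h)
  | mp _ _ ih₁ ih₂ => exact .mp ih₁ ih₂

theorem Derives.theorem_of_empty {φ : Form P} (h : Derives ∅ φ) : Theorem φ := by
  induction h with
  | thm h => exact h
  | hyp h => exact h.elim
  | mp _ _ ih₁ ih₂ => exact .MP _ _ ih₁ ih₂

theorem Derives.exists_of_sUnion {c : Set (Set (Form P))} (hc : IsChain (· ⊆ ·) c)
    (hne : c.Nonempty) {φ : Form P} (h : Derives (⋃₀ c) φ) : ∃ Γ ∈ c, Derives Γ φ := by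
  induction h with
  | thm h => exact hne.imp fun Γ hΓ => ⟨hΓ, .thm h⟩
  | hyp h =>
    obtain ⟨Γ, hΓ, h⟩ := h
    exact ⟨Γ, hΓ, .hyp h⟩
  | mp _ _ ih₁ ih₂ =>
    obtain ⟨Γ₁, hΓ₁, h₁⟩ := ih₁
    obtain ⟨Γ₂, hΓ₂, h₂⟩ := ih₂
    rcases hc.total hΓ₁ hΓ₂ with h | h
    · exact ⟨Γ₂, hΓ₂, (h₁.mono h).mp h₂⟩
    · exact ⟨Γ₁, hΓ₁, h₁.mp (h₂.mono h)⟩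

/-- Maximal consistent sets, described by their closure properties: they contain the theorems, are
closed under modus ponens, and contain exactly one of `φ` and `¬φ` for each `φ`. -/
structure IsMaxConsistent (Γ : Set (Form P)) : Prop where
  thm {φ : Form P} : Theorem φ → φ ∈ Γ
  mp {φ ψ : Form P} : imp φ ψ ∈ Γ → φ ∈ Γ → ψ ∈ Γ
  neg_mem {φ : Form P} : neg φ ∈ Γ ↔ φ ∉ Γ

theorem IsMaxConsistent.and_mem {Γ : Set (Form P)} (h : IsMaxConsistent Γ) {φ ψ : Form P} :
    and φ ψ ∈ Γ ↔ φ ∈ Γ ∧ ψ ∈ Γ := by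
  refine ⟨fun hΓ => ⟨h.mp (h.thm (.P _ ?_)) hΓ, h.mp (h.thm (.P _ ?_)) hΓ⟩,
    fun hΓ => h.mp (h.mp (h.thm (.P _ ?_)) hΓ.1) hΓ.2⟩ <;>
  · intro t hn ha; simp only [imp, hn, ha]; tauto

/-- Lindenbaum's lemma. -/
theorem exists_isMaxConsistent {S : Set (Form P)} {χ : Form P} (hS : ¬ Derives S χ) :
    ∃ Γ, S ⊆ Γ ∧ IsMaxConsistent Γ ∧ χ ∉ Γ := by
  obtain ⟨Γ, hSΓ, hmax⟩ := zorn_subset_nonempty {Γ : Set (Form P) | ¬ Derives Γ χ}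
    (fun c hcS hc hne => ⟨⋃₀ c, fun h => by
      obtain ⟨Γ, hΓ, h⟩ := h.exists_of_sUnion hc hne
      exact hcS hΓ h, fun s hs => Set.subset_sUnion_of_mem hs⟩) S hS
  have hχ : ¬ Derives Γ χ := hmax.prop
  have himp : ∀ {α}, α ∉ Γ → Derives Γ (imp α χ) := by
    intro α hα
    by_contra hcon
    exact hα (hmax.le_of_ge (y := insert α Γ) (fun h => hcon h.deduction)
      (Set.subset_insert _ _) (Set.mem_insert _ _))
  have hclosed : ∀ {α}, Derives Γ α → α ∈ Γ := by
    intro α hα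
    by_contra h
    exact hχ ((himp h).mp hα)
  refine ⟨Γ, hSΓ, ⟨fun h => hclosed (.thm h), fun h₁ h₂ => hclosed ((Derives.hyp h₁).mp (.hyp h₂)),
    fun {φ} => ⟨fun h₁ h₂ => hχ ?_, fun h => ?_⟩⟩, fun h => hχ (.hyp h)⟩
  · refine .mp (.mp (.taut ?_) (.hyp h₁)) (.hyp h₂)
    intro t hn ha; simp only [imp, hn, ha]; tauto
  · by_contra h'
    refine hχ (.mp (.mp (.taut ?_) (himp h)) (himp h'))
    intro t hn ha; simp only [imp, hn, ha]; tauto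

/-- Agreement on all formulas `D_B φ`. By `TD`, `D4` and `D5` this is the usual accessibility
relation of the canonical model: every `φ` with `D_B φ ∈ Γ` belongs to `Δ`. -/
def DistEquiv (B : Set A) (Γ Δ : Set (Form P)) : Prop := ∀ φ, dist B φ ∈ Γ ↔ dist B φ ∈ Δ

theorem DistEquiv.anti {B C : Set A} (hBC : B ⊆ C) {Γ Δ : Set (Form P)} (hΓ : IsMaxConsistent Γ)
    (hΔ : IsMaxConsistent Δ) (h : DistEquiv C Γ Δ) : DistEquiv B Γ Δ := by
  -- `D_B φ` is equivalent to `D_C D_B φ`.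
  have key : ∀ {Θ : Set (Form P)}, IsMaxConsistent Θ → ∀ φ,
      dist B φ ∈ Θ ↔ dist C (dist B φ) ∈ Θ := fun hΘ φ =>
    ⟨fun h => hΘ.mp (hΘ.thm (.W B C _ hBC)) (hΘ.mp (hΘ.thm (.D4 B φ)) h),
      fun h => hΘ.mp (hΘ.thm (.TD C _)) h⟩
  intro φ
  rw [key hΓ, key hΔ, h]

theorem IsMaxConsistent.exists_distEquiv {Γ : Set (Form P)} (hΓ : IsMaxConsistent Γ) {B : Set A}
    {φ : Form P} (h : dist B φ ∉ Γ) : ∃ Δ, IsMaxConsistent Δ ∧ DistEquiv B Δ Γ ∧ φ ∉ Δ := by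
  have hder : ∀ {ψ}, Derives {ψ | dist B ψ ∈ Γ} ψ → dist B ψ ∈ Γ := by
    intro ψ hψ
    induction hψ with
    | thm h => exact hΓ.thm (.ND B _ h)
    | hyp h => exact h
    | mp _ _ ih₁ ih₂ => exact hΓ.mp (hΓ.mp (hΓ.thm (.KD B _ _)) ih₁) ih₂
  obtain ⟨Δ, hsub, hΔ, hφ⟩ := exists_isMaxConsistent fun h' => h (hder h')
  refine ⟨Δ, hΔ, fun ψ => ⟨fun hψ => ?_, fun hψ => hsub (hΓ.mp (hΓ.thm (.D4 B ψ)) hψ)⟩, hφ⟩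
  by_contra hcon
  exact hΔ.neg_mem.1 (hsub (hΓ.mp (hΓ.thm (.D5 B ψ)) (hΓ.neg_mem.2 hcon))) hψ

theorem DistEquiv.atom_mem {Γ Δ : Set (Form P)} (hΓ : IsMaxConsistent Γ) (hΔ : IsMaxConsistent Δ)
    {p : P} (h : DistEquiv {owner p} Γ Δ) : atom p ∈ Γ → atom p ∈ Δ := by
  intro hp
  by_contra hcon
  have hK : dist {owner p} (atom p) ∉ Γ := fun h' => hcon (hΔ.mp (hΔ.thm (.TD _ _)) ((h _).1 h'))
  have hK' : dist {owner p} (neg (atom p)) ∉ Γ := fun h' =>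
    hΓ.neg_mem.1 (hΓ.mp (hΓ.thm (.TD _ _)) h') hp
  have hL := hΓ.thm (.L p)
  rw [or, hΓ.neg_mem, hΓ.and_mem, hΓ.neg_mem, hΓ.neg_mem] at hL
  exact hL ⟨hK, hK'⟩

end Form

/-! ### Realising group relations as intersections -/

/-- A family of equivalence relations indexed by groups, decreasing in the group and universal for
the empty group, is a bounded morphic image of one in which the relation of a group is the
intersection of the relations of its members. -/
theorem exists_realisation {A X : Type} [Finite A] (r : Set A → Setoid X)
    (hanti : ∀ {B C}, B ⊆ C → ∀ {x y}, r C x y → r B x y) (hempty : ∀ x y, r ∅ x y) :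
    ∃ (W : Type) (f : W → X) (s : A → Setoid W), Function.Surjective f ∧
      (∀ B v w, (∀ a ∈ B, s a v w) → r B (f v) (f w)) ∧
      (∀ B w y, r B y (f w) → ∃ v, f v = y ∧ ∀ a ∈ B, s a v w) := by
  classical
  have := Fintype.ofFinite A
  let π (B : Set A) : (X →₀ ℤ) → (Quotient (r B) →₀ ℤ) := Finsupp.mapDomain (Quotient.mk (r B))
  have hπ : ∀ {B C}, B ⊆ C → ∀ {g h : X →₀ ℤ}, π C g = π C h → π B g = π B h := by
    intro B C hBC g h hgh
    let q : Quotient (r C) → Quotient (r B) := Quotient.map id fun _ _ h => hanti hBC h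
    have hq : ∀ g, π B g = Finsupp.mapDomain q (π C g) := fun g => by
      rw [← Finsupp.mapDomain_comp]; rfl
    rw [hq, hq, hgh]
  -- `s a` relates worlds with equal entries for groups without `a`, all entries equal modulo the
  -- relation of their group, and equal difference between the world and its ledger total.
  let s (a : A) : Setoid (X × (Set A → X →₀ ℤ)) :=
    { r := fun v w => (∀ B, a ∉ B → v.2 B = w.2 B) ∧ (∀ B, π B (v.2 B) = π B (w.2 B)) ∧
        Finsupp.single v.1 1 - ∑ B, v.2 B = Finsupp.single w.1 1 - ∑ B, w.2 B
      iseqv :=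
        { refl := fun v => ⟨fun _ _ => rfl, fun _ => rfl, rfl⟩
          symm := fun h => ⟨fun B hB => (h.1 B hB).symm, fun B => (h.2.1 B).symm, h.2.2.symm⟩
          trans := fun h h' => ⟨fun B hB => (h.1 B hB).trans (h'.1 B hB),
            fun B => (h.2.1 B).trans (h'.2.1 B), h.2.2.trans h'.2.2⟩ } }
  refine ⟨X × (Set A → X →₀ ℤ), Prod.fst, s, fun x => ⟨(x, 0), rfl⟩, ?_, ?_⟩
  · rintro B ⟨x, g⟩ ⟨y, h⟩ hvw
    rcases B.eq_empty_or_nonempty with rfl | ⟨a, ha⟩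
    · exact hempty _ _
    · -- Entries of groups not containing `B` are unchanged, the others change by a chain which
      -- vanishes modulo `r B`; hence so does `y - x`.
      have hC : ∀ C, π B (g C) = π B (h C) := by
        intro C
        by_cases hBC : B ⊆ C
        · exact hπ hBC ((hvw a ha).2.1 C)
        · obtain ⟨b, hb, hbC⟩ := Set.not_subset.1 hBC
          exact congrArg (π B) ((hvw b hb).1 C hbC)
      have hsum : π B (∑ C, g C) = π B (∑ C, h C) := by
        simp only [π] at hC ⊢
        simp only [Finsupp.mapDomain_finsetSum, hC]
      have htot : Finsupp.single x (1 : ℤ) + ∑ C, h C = Finsupp.single y 1 + ∑ C, g C := by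
        have h₁ : Finsupp.single x (1 : ℤ) - ∑ C, g C = Finsupp.single y 1 - ∑ C, h C :=
          (hvw a ha).2.2
        rw [sub_eq_sub_iff_add_eq_add] at h₁
        exact h₁
      have hsingle := congrArg (π B) htot
      simp only [π, Finsupp.mapDomain_add] at hsingle hsum
      rw [hsum, add_left_inj, Finsupp.mapDomain_single, Finsupp.mapDomain_single] at hsingle
      exact Quotient.exact (Finsupp.single_left_injective one_ne_zero hsingle)
  · rintro B ⟨x, g⟩ y hyx
    -- The step from `x` to `y` is recorded in the entry of `B`.
    refine ⟨(y, Function.update g B (g B + (Finsupp.single y 1 - Finsupp.single x 1))), rfl,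
      fun a ha => ⟨fun C hC => ?_, fun C => ?_, ?_⟩⟩
    · exact Function.update_of_ne (fun h => hC (by rw [h]; exact ha)) _ _
    · rcases eq_or_ne C B with rfl | hCB
      · have hq : Quotient.mk (r C) y = Quotient.mk (r C) x := Quotient.sound hyx
        have : π C (g C + Finsupp.single y 1) = π C (g C + Finsupp.single x 1) := by
          simp only [π, Finsupp.mapDomain_add, Finsupp.mapDomain_single, hq]
        have h₂ : g C + (Finsupp.single y 1 - Finsupp.single x 1) + Finsupp.single x 1 =
          g C + Finsupp.single y 1 := by abel
        have h₃ := congrArg (π C) h₂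
        rw [this] at h₃
        simp only [π, Finsupp.mapDomain_add, add_left_inj] at h₃
        simpa [π, Finsupp.mapDomain_add] using h₃
      · simp only [Function.update_of_ne hCB]
    · have h₁ := Finset.sum_update_of_mem (Finset.mem_univ B) g
        (g B + (Finsupp.single y 1 - Finsupp.single x 1))
      have h₂ := Finset.add_sum_erase Finset.univ g (Finset.mem_univ B)
      rw [Finset.sdiff_singleton_eq_erase] at h₁
      simp only [h₁, ← h₂]
      abel

/-! ### Completeness -/

namespace Form

variable {A P' : Type} {P : Set (P' × A)}

theorem UpdFree.theorem_of_valid [Finite A] {φ : Form P} (hφ : UpdFree φ) (hv : Valid.{w} φ) :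
    Theorem φ := by
  by_contra hnot
  have hnd : ¬ Derives ∅ φ := fun h => hnot h.theorem_of_empty
  obtain ⟨Γ, -, hΓ, hφΓ⟩ := exists_isMaxConsistent hnd
  -- Restricting to one class of `∼_∅` makes `∼_∅` universal.
  let X := {Δ : Set (Form P) // IsMaxConsistent Δ ∧ DistEquiv ∅ Δ Γ}
  let r (B : Set A) : Setoid X :=
    { r := fun Δ Θ => DistEquiv B Δ.1 Θ.1
      iseqv := ⟨fun _ _ => Iff.rfl, fun h φ => (h φ).symm, fun h h' φ => (h φ).trans (h' φ)⟩ }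
  obtain ⟨W, f, s, hf, hforth, hback⟩ := exists_realisation r
    (fun {B C} hBC {Δ Θ} h => DistEquiv.anti hBC Δ.2.1 Θ.2.1 h)
    (fun Δ Θ φ => (Δ.2.2 φ).trans (Θ.2.2 φ).symm)
  let M : EpistemicModel P (ULift.{w} W) :=
    { rel := fun a v w => s a v.down w.down
      equivalence := fun a => ⟨fun _ => (s a).refl _, fun h => (s a).symm h,
        fun h h' => (s a).trans h h'⟩
      val := fun v => {p | atom p ∈ (f v.down).1}
      locality := by
        intro a v w h
        have key : ∀ {v w}, s a v w → ∀ p : P, owner p = a → atom p ∈ (f v).1 →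
            atom p ∈ (f w).1 := by
          rintro v w h p rfl
          refine DistEquiv.atom_mem (f v).2.1 (f w).2.1 (hforth {owner p} v w ?_)
          rintro _ rfl
          exact h
        ext p
        exact ⟨fun hp => ⟨key h p hp.2 hp.1, hp.2⟩,
          fun hp => ⟨key ((s a).symm h) p hp.2 hp.1, hp.2⟩⟩ }
  have truth : ∀ ψ : Form P, UpdFree ψ → ∀ v, Sat ψ M v ↔ ψ ∈ (f v.down).1 := by
    intro ψ hψ
    induction ψ with
    | atom p => intro v; rfl
    | neg ψ ih => intro v; rw [(f v.down).2.1.neg_mem, ← ih hψ]; rfl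
    | and ψ₁ ψ₂ ih₁ ih₂ =>
      intro v; rw [(f v.down).2.1.and_mem, ← ih₁ hψ.1, ← ih₂ hψ.2]; rfl
    | dist B ψ ih =>
      intro v
      constructor
      · intro h
        by_contra hcon
        obtain ⟨Δ, hΔ, hΔv, hψΔ⟩ := (f v.down).2.1.exists_distEquiv hcon
        have hΔΓ : DistEquiv ∅ Δ Γ := fun χ =>
          (hΔv.anti (Set.empty_subset B) hΔ (f v.down).2.1 χ).trans ((f v.down).2.2 χ)
        obtain ⟨u, hu, huv⟩ := hback B v.down ⟨Δ, hΔ, hΔΓ⟩ hΔv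
        have := (ih hψ ⟨u⟩).1 (h ⟨u⟩ huv)
        rw [hu] at this
        exact hψΔ this
      · intro h u huv
        have hu := (hforth B u.down v.down huv ψ).2 h
        exact (ih hψ u).2 ((f u.down).2.1.mp ((f u.down).2.1.thm (.TD B ψ)) hu)
    | upd => exact hψ.elim
  obtain ⟨v, hvΓ⟩ := hf ⟨Γ, hΓ, fun _ => Iff.rfl⟩
  have := (truth φ hφ ⟨v⟩).1 (hv _ M ⟨v⟩)
  rw [hvΓ] at this
  exact hφΓ this

end Form

end CommunicationPatternLogic

theorem mainTheorem1 {A P' : Type} [Finite A] [Countable P'] (P : Set (P' × A))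
    (φ : CommunicationPatternLogic.Form P) :
    CommunicationPatternLogic.Form.Theorem φ ↔
      CommunicationPatternLogic.Form.Valid.{w} φ := by
  open CommunicationPatternLogic Form in
  refine ⟨fun h => h.sound, fun h => ?_⟩
  obtain ⟨ψ, hψ, hφψ⟩ := exists_updFree_iff φ
  refine .MP _ _ hφψ.iff_mpr (hψ.theorem_of_valid.{w} fun W M x => ?_)
  exact (sat_iff M x φ ψ).1 (hφψ.sound W M x) |>.1 (h W M x)
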